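/- **Setting.** Let $d\ge 2$, let $\Omega\subset\mathbb R^d$ be a non-empty bounded open set with $\mathcal C^1$ boundary, with outward unit normal $n(x)$ and surface measure $\pi(\mathrm dx)$ on $\partial\Omega$. Let $\boldsymbol m$ be a ($\sigma$-finite) nonnegative Borel measure on $\mathbb R^d$ which is invariant under all orthogonal transformations, with support $V$, such that $0\in V$, $\boldsymbol m(\{0\})=0$ and $\boldsymbol m(V\cap B(0,r))>0$ for all $r>0$. Let $$\mathbb X_0=L^1(\Omega\times V,\mathrm dx\otimes\boldsymbol m(\mathrm dv)),\qquad \Gamma_\pm=\{(x,v)\in\partial\Omega\times V:\ \pm v\cdot n(x)>0\},$$ $$L^1_\pm=L^1(\Gamma_\pm,\mathrm d\mu_\pm),\qquad \mathrm d\mu_\pm(x,v)=|v\cdot n(x)|\,\pi(\mathrm dx)\otimes\boldsymbol m(\mathrm dv)$$ (complex-valued functions). For $(x,v)\in\Gamma_+$ put $\tau_-(x,v)=\inf\{s>0:\ x-sv\notin\Omega\}$, and for $\lambda\in\mathbb C$ with $\mathrm{Re}\,\lambda\ge0$ let $\mathsf M_\lambda: L^1_-\to L^1_+$ be the bounded operator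 $$\mathsf M_\lambda u(x,v)=u(x-\tau_-(x,v)v,v)\,e^{-\lambda\tau_-(x,v)},\qquad (x,v)\in\Gamma_+ .$$ For a bounded linear operator $\mathsf H:L^1_+\to L^1_-$, let $\mathsf T_{\mathsf H}$ be the operator in $\mathbb X_0$ given by $$\mathscr D(\mathsf T_{\mathsf H})=\{f\in\mathbb X_0:\ v\cdot\nabla_xf\in\mathbb X_0,\ f_{|\Gamma_\pm}\in L^1_\pm,\ f_{|\Gamma_-}=\mathsf H(f_{|\Gamma_+})\},\qquad \mathsf T_{\mathsf H}f=-v\cdot\nabla_xf,$$ where $v\cdot\nabla_xf$ is taken in the sense of distributions and the traces $f_{|\Gamma_\pm}$ are those in Green's formula $$\int_{\Omega\times V}\big(f\,v\cdot\nabla_x\varphi+\varphi\,v\cdot\nabla_xf\big)\,\mathrm dx\,\boldsymbol m(\mathrm dv)=\int_{\Gamma_+}f_{|\Gamma_+}\varphi\,\mathrm d\mu_+-\int_{\Gamma_-}f_{|\Gamma_-}\varphi\,\mathrm d\mu_-\qquad\forall\varphi\in\mathcal C^\infty_c(\mathbb R^d\times\mathbb R^d).$$ **Assumptions on $\mathsf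 H$.** The operator $\mathsf H$ is stochastic, i.e. nonnegative with $\int_{\Gamma_-}\mathsf H\psi\,\mathrm d\mu_-=\int_{\Gamma_+}\psi\,\mathrm d\mu_+$ for all $\psi\in L^1_+$, and 1. there is an integer $n\ge0$ such that $\mathsf H$ is bounded from $L^1_+$ to $L^1(\Gamma_-,\max(1,|v|^{-(n+1)})\,\mathrm d\mu_-)$; 2. $\mathsf H\mathsf M_0\mathsf H:L^1_+\to L^1_-$ is weakly compact; 3. $\mathsf M_0\mathsf H$ is irreducible on $L^1_+$ (its only invariant closed lattice ideals are $\{0\}$ and $L^1_+$); 4. there is $\ell\in\mathbb N$ such that $\lim_{|\eta|\to\infty}\|(\mathsf M_{\varepsilon+i\eta}\mathsf H)^\ell\|_{\mathscr B(L^1_+)}=0$ for all $\varepsilon\ge0$. **Theorem.** Under these assumptions the whole imaginary axis lies in the spectrum of $\mathsf T_{\mathsf H}$: $$ i\mathbb R\subset\mathfrak S(\mathsf T_{\mathsf H}),$$ where $\mathfrak S(\mathsf T_{\mathsf H})$ is the complement of the set of $\lambda\in\mathbb C$ for which $\lambda-\mathsf T_{\mathsf H}:\mathscr D(\mathsf T_{\mathsf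 H})\to\mathbb X_0$ has an inverse that is bounded on $\mathbb X_0$. -/

import Mathlib

open MeasureTheory Filter Topology Set
open scoped ContDiff ENNReal NNReal InnerProductSpace

noncomputable section

namespace Kinetic

/-- The Euclidean space `ℝ^d`. -/
abbrev E (d : ℕ) := EuclideanSpace ℝ (Fin d)

/-! ### Domains with `C¹` boundary, outward unit normal, surface measure -/

/-- On the open neighbourhood `U` of `x`, the set `Ω` is `{ρ < 0}` for a `C¹` function `ρ`
without critical points. -/
structure IsLocalDefiningFunction {d : ℕ} (Ω : Set (E d)) (x : E d) (U : Set (E d))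
    (ρ : E d → ℝ) : Prop where
  isOpen : IsOpen U
  mem : x ∈ U
  contDiffOn : ContDiffOn ℝ 1 ρ U
  gradient_ne_zero : ∀ y ∈ U, gradient ρ y ≠ 0
  mem_iff : ∀ y ∈ U, y ∈ Ω ↔ ρ y < 0

/-- `∂Ω` is of class `C¹`. -/
def HasC1Boundary {d : ℕ} (Ω : Set (E d)) : Prop :=
  ∀ x ∈ frontier Ω, ∃ U ρ, IsLocalDefiningFunction Ω x U ρ

/-- `n` is the outward unit normal to `∂Ω` at the boundary point `x`. -/
def IsOuterUnitNormal {d : ℕ} (Ω : Set (E d)) (x n : E d) : Prop :=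
  x ∈ frontier Ω ∧ ∃ U ρ, IsLocalDefiningFunction Ω x U ρ ∧
    n = ‖gradient ρ x‖⁻¹ • gradient ρ x

open Classical in
/-- The outward unit normal `n(x)` (and `0` where there is none, in particular off `∂Ω`). It is
unique by `IsOuterUnitNormal.unique` below. -/
def outerNormal {d : ℕ} (Ω : Set (E d)) (x : E d) : E d :=
  if h : ∃ n, IsOuterUnitNormal Ω x n then h.choose else 0

/-- The surface measure `π(dx)` on `∂Ω`: the `(d-1)`-dimensional Hausdorff measure, normalized as
in Euclidean geometry, restricted to `∂Ω`. -/
def surfaceMeasure {d : ℕ} (Ω : Set (E d)) : Measure (E d) :=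
  (Measure.euclideanHausdorffMeasure (d - 1)).restrict (frontier Ω)

/-! ### Standing assumptions on the phase space `Ω × V`, where `V` is the support of `m` -/

/-- `Ω` is a (non-empty) bounded open set with `C¹` boundary and `m` is an orthogonally invariant
Borel measure on `ℝ^d` whose support `V` contains `0`, with `m({0}) = 0` and
`m(V ∩ B(0,r)) > 0` for all `r > 0`. -/
structure PhaseSpaceAssumption {d : ℕ} (Ω : Set (E d)) (m : Measure (E d)) : Prop where
  nonempty : Ω.Nonempty
  isOpen : IsOpen Ω
  isBounded : Bornology.IsBounded Ω
  c1Boundary : HasC1Boundary Ω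
  orthogonallyInvariant : ∀ A : E d ≃ₗᵢ[ℝ] E d, m.map A = m
  zero_mem_support : (0 : E d) ∈ m.support
  measure_zero : m {0} = 0
  measure_ball_pos : ∀ r : ℝ, 0 < r → 0 < m (m.support ∩ Metric.ball 0 r)

/-! ### The spaces `X₀`, `L¹₊`, `L¹₋`. The complement of `V` is `m`-null. -/

/-- The measure `dx ⊗ m(dv)` on `Ω × V`. -/
def phaseMeasure {d : ℕ} (Ω : Set (E d)) (m : Measure (E d)) : Measure (E d × E d) :=
  ((volume : Measure (E d)).restrict Ω).prod m

/-- `X₀ = L¹(Ω × V, dx ⊗ m(dv))`. -/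
abbrev X0 {d : ℕ} (Ω : Set (E d)) (m : Measure (E d)) := Lp ℂ 1 (phaseMeasure Ω m)

/-- `Γ₊ = {(x,v) ∈ ∂Ω × V : v · n(x) > 0}`. -/
def GammaPlus {d : ℕ} (Ω : Set (E d)) (m : Measure (E d)) : Set (E d × E d) :=
  {p | p.1 ∈ frontier Ω ∧ p.2 ∈ m.support ∧ 0 < ⟪p.2, outerNormal Ω p.1⟫_ℝ}

/-- `Γ₋ = {(x,v) ∈ ∂Ω × V : v · n(x) < 0}`. -/
def GammaMinus {d : ℕ} (Ω : Set (E d)) (m : Measure (E d)) : Set (E d × E d) :=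
  {p | p.1 ∈ frontier Ω ∧ p.2 ∈ m.support ∧ ⟪p.2, outerNormal Ω p.1⟫_ℝ < 0}

/-- The measure `|v · n(x)| π(dx) ⊗ m(dv)` on `∂Ω × V`. -/
def fluxMeasure {d : ℕ} (Ω : Set (E d)) (m : Measure (E d)) : Measure (E d × E d) :=
  ((surfaceMeasure Ω).prod m).withDensity
    (fun p => ENNReal.ofReal |⟪p.2, outerNormal Ω p.1⟫_ℝ|)

/-- `μ₊`, the flux measure on `Γ₊`. -/
def muPlus {d : ℕ} (Ω : Set (E d)) (m : Measure (E d)) : Measure (E d × E d) :=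
  (fluxMeasure Ω m).restrict (GammaPlus Ω m)

/-- `μ₋`, the flux measure on `Γ₋`. -/
def muMinus {d : ℕ} (Ω : Set (E d)) (m : Measure (E d)) : Measure (E d × E d) :=
  (fluxMeasure Ω m).restrict (GammaMinus Ω m)

/-- `L¹₊ = L¹(Γ₊, dμ₊)`. -/
abbrev L1Plus {d : ℕ} (Ω : Set (E d)) (m : Measure (E d)) := Lp ℂ 1 (muPlus Ω m)

/-- `L¹₋ = L¹(Γ₋, dμ₋)`. -/
abbrev L1Minus {d : ℕ} (Ω : Set (E d)) (m : Measure (E d)) := Lp ℂ 1 (muMinus Ω m)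

/-! ### The transport operator `T_H` -/

/-- Smooth compactly supported functions on `ℝ^d × ℝ^d`. -/
structure IsTestFunction {d : ℕ} (φ : E d × E d → ℝ) : Prop where
  contDiff : ContDiff ℝ ∞ φ
  hasCompactSupport : HasCompactSupport φ

/-- `(v · ∇ₓ φ)(x,v)` for a differentiable `φ`. -/
def streaming {d : ℕ} (φ : E d × E d → ℝ) (p : E d × E d) : ℝ :=
  fderiv ℝ φ p (p.2, 0)

/-- `v · ∇ₓ f = g` in the sense of distributions on `Ω × V`, for `f, g ∈ X₀`. -/
def HasWeakStreaming {d : ℕ} (Ω : Set (E d)) (m : Measure (E d)) (f g : X0 Ω m) : Prop :=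
  ∀ φ : E d × E d → ℝ, IsTestFunction φ → tsupport φ ⊆ Ω ×ˢ univ →
    ∫ p, f p * (streaming φ p : ℂ) ∂(phaseMeasure Ω m) =
      - ∫ p, g p * (φ p : ℂ) ∂(phaseMeasure Ω m)

/-- `f₊ ∈ L¹₊` and `f₋ ∈ L¹₋` are the traces on `Γ₊` and `Γ₋` of `f ∈ X₀` with
`v · ∇ₓ f = g ∈ X₀`, in the sense of Green's formula
`∫ (f v · ∇ₓ φ + g φ) dx m(dv) = ∫_{Γ₊} f₊ φ dμ₊ - ∫_{Γ₋} f₋ φ dμ₋`. -/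
def HasTraces {d : ℕ} (Ω : Set (E d)) (m : Measure (E d)) (f g : X0 Ω m)
    (fPlus : L1Plus Ω m) (fMinus : L1Minus Ω m) : Prop :=
  ∀ φ : E d × E d → ℝ, IsTestFunction φ →
    ∫ p, f p * (streaming φ p : ℂ) ∂(phaseMeasure Ω m) +
        ∫ p, g p * (φ p : ℂ) ∂(phaseMeasure Ω m) =
      ∫ p, fPlus p * (φ p : ℂ) ∂(muPlus Ω m) - ∫ p, fMinus p * (φ p : ℂ) ∂(muMinus Ω m)

lemma IsOuterUnitNormal.unique {d : ℕ} {Ω : Set (E d)} {x n₁ n₂ : E d}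
    (h₁ : IsOuterUnitNormal Ω x n₁) (h₂ : IsOuterUnitNormal Ω x n₂) : n₁ = n₂ := by
  obtain ⟨_, U₁, ρ₁, d₁, rfl⟩ := h₁
  obtain ⟨hx, U₂, ρ₂, d₂, rfl⟩ := h₂
  -- a defining function vanishes at `x`
  have zero : ∀ U ρ, IsLocalDefiningFunction Ω x U ρ → ρ x = 0 := by
    intro U ρ D
    have hc : ContinuousAt ρ x := D.contDiffOn.continuousOn.continuousAt (D.isOpen.mem_nhds D.mem)
    have hU : ∀ᶠ y in 𝓝 x, y ∈ U := D.isOpen.mem_nhds D.mem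
    rcases lt_trichotomy (ρ x) 0 with h | h | h
    · have : ∀ᶠ y in 𝓝 x, y ∈ Ω := by
        filter_upwards [hU, hc.eventually_lt_const h] with y hy h'
        exact (D.mem_iff y hy).2 h'
      exact absurd (mem_interior_iff_mem_nhds.2 this) hx.2
    · exact h
    · have : ∀ᶠ y in 𝓝 x, y ∉ Ω := by
        filter_upwards [hU, hc.eventually_const_lt h] with y hy h'
        exact fun hΩ => absurd ((D.mem_iff y hy).1 hΩ) (not_lt.2 h'.le)
      exact absurd this (mem_closure_iff_frequently.1 hx.1)
  -- its derivative along `w` has the sign of `⟪∇ρ, w⟫`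
  have deriv : ∀ U ρ, IsLocalDefiningFunction Ω x U ρ → ∀ w : E d,
      HasDerivAt (fun t : ℝ => ρ (x + t • w)) ⟪gradient ρ x, w⟫_ℝ 0 := by
    intro U ρ D w
    have hd : DifferentiableAt ℝ ρ x :=
      (D.contDiffOn.differentiableOn (by norm_num)).differentiableAt (D.isOpen.mem_nhds D.mem)
    have hg : HasFDerivAt ρ (InnerProductSpace.toDual ℝ (E d) (gradient ρ x)) (x + (0 : ℝ) • w) := by
      simpa using hd.hasGradientAt.hasFDerivAt
    have hl : HasDerivAt (fun t : ℝ => x + t • w) w 0 := by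
      simpa using ((hasDerivAt_id (0 : ℝ)).smul_const w).const_add x
    exact hg.comp_hasDerivAt (0 : ℝ) hl
  have near : ∀ U ρ, IsLocalDefiningFunction Ω x U ρ → ∀ w : E d,
      ∀ᶠ t : ℝ in 𝓝[>] 0, x + t • w ∈ U := by
    intro U ρ D w
    have : ContinuousAt (fun t : ℝ => x + t • w) 0 := by fun_prop
    exact (this.eventually (by simpa using D.isOpen.mem_nhds D.mem)).filter_mono
      nhdsWithin_le_nhds
  have neg : ∀ U ρ, IsLocalDefiningFunction Ω x U ρ → ∀ w : E d, ⟪gradient ρ x, w⟫_ℝ < 0 →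
      ∀ᶠ t : ℝ in 𝓝[>] 0, x + t • w ∈ Ω := by
    intro U ρ D w hw
    have h := (deriv U ρ D w).tendsto_slope.mono_left (nhdsGT_le_nhdsNE 0)
    filter_upwards [h.eventually_lt_const hw, near U ρ D w, self_mem_nhdsWithin] with t ht hU h0
    refine (D.mem_iff _ hU).2 ?_
    have h0 : 0 < t := h0
    simp only [slope_def_field, zero_smul, add_zero, zero U ρ D, sub_zero] at ht
    exact (div_neg_iff.1 ht).elim (fun h => absurd h.2 (not_lt.2 h0.le)) (fun h => h.1)
  have pos : ∀ U ρ, IsLocalDefiningFunction Ω x U ρ → ∀ w : E d, 0 < ⟪gradient ρ x, w⟫_ℝ →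
      ∀ᶠ t : ℝ in 𝓝[>] 0, x + t • w ∉ Ω := by
    intro U ρ D w hw
    have h := (deriv U ρ D w).tendsto_slope.mono_left (nhdsGT_le_nhdsNE 0)
    filter_upwards [h.eventually_const_lt hw, near U ρ D w, self_mem_nhdsWithin] with t ht hU h0
    have h0 : 0 < t := h0
    simp only [slope_def_field, zero_smul, add_zero, zero U ρ D, sub_zero] at ht
    exact fun hΩ => absurd ((D.mem_iff _ hU).1 hΩ)
      (not_lt.2 ((div_pos_iff_of_pos_right h0).1 ht).le)
  by_contra hne
  set a := gradient ρ₁ x with ha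
  set b := gradient ρ₂ x with hb
  have ha0 : 0 < ‖a‖ := norm_pos_iff.2 (d₁.gradient_ne_zero x d₁.mem)
  have hb0 : 0 < ‖b‖ := norm_pos_iff.2 (d₂.gradient_ne_zero x d₂.mem)
  have hab : ⟪a, b⟫_ℝ < ‖a‖ * ‖b‖ := by
    refine inner_lt_norm_mul_iff_real.2 fun h => hne ?_
    have : ‖a‖⁻¹ • a = (‖a‖⁻¹ * ‖b‖⁻¹) • (‖b‖ • a) := by
      rw [smul_smul, mul_assoc, inv_mul_cancel₀ hb0.ne', mul_one]
    rw [this, h, smul_smul, mul_comm ‖a‖⁻¹, mul_assoc, inv_mul_cancel₀ ha0.ne', mul_one]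
  have h1 : ⟪a, ‖a‖ • b - ‖b‖ • a⟫_ℝ < 0 := by
    rw [inner_sub_right, inner_smul_right, inner_smul_right, real_inner_self_eq_norm_sq]
    nlinarith
  have h2 : 0 < ⟪b, ‖a‖ • b - ‖b‖ • a⟫_ℝ := by
    rw [inner_sub_right, inner_smul_right, inner_smul_right, real_inner_self_eq_norm_sq,
      real_inner_comm]
    nlinarith
  obtain ⟨t, ht, ht'⟩ := ((neg U₁ ρ₁ d₁ _ h1).and (pos U₂ ρ₂ d₂ _ h2)).exists
  exact ht' ht

lemma integrable_mul_of_compact {α : Type*} [TopologicalSpace α] [MeasurableSpace α]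
    [OpensMeasurableSpace α] [SecondCountableTopology α] {μ : Measure α}
    (f : Lp ℂ 1 μ) {h : α → ℝ} (hc : Continuous h) (hs : HasCompactSupport h) :
    Integrable (fun p => f p * (h p : ℂ)) μ := by
  obtain ⟨C, hC⟩ := hs.exists_bound_of_continuous hc
  have hb : ∀ᵐ p ∂μ, ‖(h p : ℂ)‖ ≤ C := ae_of_all _ fun p => by simpa using hC p
  have hm : AEStronglyMeasurable (fun p => (h p : ℂ)) μ :=
    (Complex.continuous_ofReal.comp hc).aestronglyMeasurable
  simpa [mul_comm] using (L1.integrable_coeFn f).bdd_mul hm hb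

lemma integral_add_mul {α : Type*} [TopologicalSpace α] [MeasurableSpace α]
    [OpensMeasurableSpace α] [SecondCountableTopology α] {μ : Measure α}
    (f g : Lp ℂ 1 μ) {h : α → ℝ} (hc : Continuous h) (hs : HasCompactSupport h) :
    ∫ p, (f + g : Lp ℂ 1 μ) p * (h p : ℂ) ∂μ =
      ∫ p, f p * (h p : ℂ) ∂μ + ∫ p, g p * (h p : ℂ) ∂μ := by
  rw [← integral_add (integrable_mul_of_compact f hc hs) (integrable_mul_of_compact g hc hs)]
  refine integral_congr_ae ?_
  filter_upwards [Lp.coeFn_add f g] with p hp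
  rw [hp, Pi.add_apply, add_mul]

lemma integral_smul_mul {α : Type*} [MeasurableSpace α] {μ : Measure α}
    (c : ℂ) (f : Lp ℂ 1 μ) (h : α → ℝ) :
    ∫ p, (c • f : Lp ℂ 1 μ) p * (h p : ℂ) ∂μ = c * ∫ p, f p * (h p : ℂ) ∂μ := by
  rw [← integral_const_mul]
  refine integral_congr_ae ?_
  filter_upwards [Lp.coeFn_smul c f] with p hp
  rw [hp, Pi.smul_apply, smul_eq_mul, mul_assoc]

lemma IsTestFunction.continuous_streaming {d : ℕ} {φ : E d × E d → ℝ} (hφ : IsTestFunction φ) :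
    Continuous (streaming φ) := by
  have := hφ.contDiff.continuous_fderiv (by simp)
  exact this.clm_apply (continuous_snd.prodMk continuous_const)

lemma IsTestFunction.hasCompactSupport_streaming {d : ℕ} {φ : E d × E d → ℝ}
    (hφ : IsTestFunction φ) : HasCompactSupport (streaming φ) := by
  refine (hφ.hasCompactSupport.fderiv (𝕜 := ℝ)).mono fun p hp h => hp ?_
  simp [streaming, h]

/-- The graph of `T_H`: the pairs `(f, -v · ∇ₓ f)` with `f` and `v · ∇ₓ f` in `X₀`, with traces
`f₊ ∈ L¹₊` and `f₋ ∈ L¹₋`, and `f₋ = H f₊`. -/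
def transportGraph {d : ℕ} (Ω : Set (E d)) (m : Measure (E d))
    (H : L1Plus Ω m →L[ℂ] L1Minus Ω m) : Submodule ℂ (X0 Ω m × X0 Ω m) where
  carrier := {q | HasWeakStreaming Ω m q.1 (-q.2) ∧
    ∃ fPlus : L1Plus Ω m, ∃ fMinus : L1Minus Ω m,
      HasTraces Ω m q.1 (-q.2) fPlus fMinus ∧ fMinus = H fPlus}
  zero_mem' := by
    have z1 : ∀ h : E d × E d → ℝ,
        ∫ p, (0 : X0 Ω m) p * (h p : ℂ) ∂(phaseMeasure Ω m) = 0 := fun h => by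
      simpa using integral_smul_mul 0 (0 : X0 Ω m) h
    have z2 : ∀ h : E d × E d → ℝ,
        ∫ p, (0 : L1Plus Ω m) p * (h p : ℂ) ∂(muPlus Ω m) = 0 := fun h => by
      simpa using integral_smul_mul 0 (0 : L1Plus Ω m) h
    have z3 : ∀ h : E d × E d → ℝ,
        ∫ p, (0 : L1Minus Ω m) p * (h p : ℂ) ∂(muMinus Ω m) = 0 := fun h => by
      simpa using integral_smul_mul 0 (0 : L1Minus Ω m) h
    refine ⟨fun φ _ _ => ?_, 0, 0, fun φ _ => ?_, (map_zero H).symm⟩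
    · simp only [Prod.fst_zero, Prod.snd_zero, neg_zero, z1]
    · simp only [Prod.fst_zero, Prod.snd_zero, neg_zero, z1, z2, z3, sub_zero, add_zero]
  add_mem' := by
    rintro ⟨f, a⟩ ⟨g, b⟩ ⟨hf, f₁, f₂, htf, hHf⟩ ⟨hg, g₁, g₂, htg, hHg⟩
    refine ⟨fun φ hφ hs => ?_, f₁ + g₁, f₂ + g₂, fun φ hφ => ?_, by rw [hHf, hHg, map_add]⟩
    · have h1 := hf φ hφ hs
      have h2 := hg φ hφ hs
      simp only [Prod.mk_add_mk, neg_add] at h1 h2 ⊢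
      rw [integral_add_mul _ _ hφ.continuous_streaming hφ.hasCompactSupport_streaming,
        integral_add_mul _ _ hφ.contDiff.continuous hφ.hasCompactSupport, h1, h2]
      ring
    · have h1 := htf φ hφ
      have h2 := htg φ hφ
      simp only [Prod.mk_add_mk, neg_add] at h1 h2 ⊢
      rw [integral_add_mul _ _ hφ.continuous_streaming hφ.hasCompactSupport_streaming,
        integral_add_mul _ _ hφ.contDiff.continuous hφ.hasCompactSupport,
        integral_add_mul _ _ hφ.contDiff.continuous hφ.hasCompactSupport,
        integral_add_mul _ _ hφ.contDiff.continuous hφ.hasCompactSupport]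
      linear_combination h1 + h2
  smul_mem' := by
    rintro c ⟨f, a⟩ ⟨hf, f₁, f₂, htf, hHf⟩
    refine ⟨fun φ hφ hs => ?_, c • f₁, c • f₂, fun φ hφ => ?_, by rw [hHf, map_smul]⟩
    · have h1 := hf φ hφ hs
      simp only [Prod.smul_mk, ← smul_neg] at h1 ⊢
      rw [integral_smul_mul, integral_smul_mul, h1]
      ring
    · have h1 := htf φ hφ
      simp only [Prod.smul_mk, ← smul_neg] at h1 ⊢
      rw [integral_smul_mul, integral_smul_mul, integral_smul_mul, integral_smul_mul]
      linear_combination c * h1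

/-- The weak derivative `v · ∇ₓ f` is unique, so `transportGraph` is the graph of an operator. -/
lemma transportGraph_singleValued {d : ℕ} {Ω : Set (E d)} (hΩ : IsOpen Ω) {m : Measure (E d)}
    [SFinite m] (H : L1Plus Ω m →L[ℂ] L1Minus Ω m) :
    ∀ q ∈ transportGraph Ω m H, q.1 = 0 → q.2 = 0 := by
  rintro ⟨f, g⟩ ⟨hw, -⟩ rfl
  have z1 : ∀ h : E d × E d → ℝ,
      ∫ p, (0 : X0 Ω m) p * (h p : ℂ) ∂(phaseMeasure Ω m) = 0 := fun h => by
    simpa using integral_smul_mul 0 (0 : X0 Ω m) h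
  have key : ∀ᵐ p ∂(phaseMeasure Ω m), p ∈ Ω ×ˢ (univ : Set (E d)) → (-g : X0 Ω m) p = 0 := by
    refine (hΩ.prod isOpen_univ).ae_eq_zero_of_integral_contDiff_smul_eq_zero
      ((L1.integrable_coeFn (-g)).locallyIntegrable.locallyIntegrableOn _) ?_
    intro φ h1 h2 h3
    have h := hw φ ⟨h1, h2⟩ h3
    simp only [z1] at h
    rw [eq_comm, neg_eq_zero] at h
    simpa [Complex.real_smul, mul_comm] using h
  have hin : ∀ᵐ p ∂(phaseMeasure Ω m), p ∈ Ω ×ˢ (univ : Set (E d)) := by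
    have : phaseMeasure Ω m = ((volume : Measure (E d)).prod m).restrict (Ω ×ˢ univ) := by
      rw [phaseMeasure, ← Measure.prod_restrict, Measure.restrict_univ]
    rw [this]
    exact ae_restrict_mem (hΩ.prod isOpen_univ).measurableSet
  have : (-g : X0 Ω m) = 0 := by
    refine Lp.ext ?_
    filter_upwards [key, hin, Lp.coeFn_zero ℂ 1 (phaseMeasure Ω m)] with p hp hi h0
    rw [hp hi, h0, Pi.zero_apply]
  exact neg_eq_zero.1 this

/-- The transport operator `T_H` with domain
`D(T_H) = {f ∈ X₀ : v · ∇ₓ f ∈ X₀, f|Γ± ∈ L¹±, f|Γ₋ = H (f|Γ₊)}` and `T_H f = -v · ∇ₓ f`. -/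
def transportOperator {d : ℕ} (Ω : Set (E d)) (m : Measure (E d))
    (H : L1Plus Ω m →L[ℂ] L1Minus Ω m) : X0 Ω m →ₗ.[ℂ] X0 Ω m :=
  (transportGraph Ω m H).toLinearPMap

/-- `T_H` acts as `-v · ∇ₓ` on its domain, and the boundary condition holds there. -/
lemma mem_transportGraph_apply {d : ℕ} {Ω : Set (E d)} (hΩ : IsOpen Ω) {m : Measure (E d)}
    [SFinite m] (H : L1Plus Ω m →L[ℂ] L1Minus Ω m) (f : (transportOperator Ω m H).domain) :
    ((f : X0 Ω m), transportOperator Ω m H f) ∈ transportGraph Ω m H :=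
  Submodule.mem_graph_toLinearPMap
    (fun q hq h0 => transportGraph_singleValued hΩ H q hq h0) f

/-! ### Spectrum of an unbounded operator -/

/-- `R` is the (bounded, everywhere defined) inverse of `z - T : D(T) → X`. -/
def IsResolventAt {X : Type*} [NormedAddCommGroup X] [NormedSpace ℂ X] (T : X →ₗ.[ℂ] X) (z : ℂ)
    (R : X →L[ℂ] X) : Prop :=
  (∀ y : X, ∃ h : R y ∈ T.domain, z • R y - T ⟨R y, h⟩ = y) ∧
    ∀ x : T.domain, R (z • (x : X) - T x) = x

/-- The spectrum of an unbounded operator `T`: the complement of its resolvent set. -/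
def unboundedSpectrum {X : Type*} [NormedAddCommGroup X] [NormedSpace ℂ X] (T : X →ₗ.[ℂ] X) :
    Set ℂ :=
  {z | ¬ ∃ R : X →L[ℂ] X, IsResolventAt T z R}

/-! ### The operators `M_λ` and the assumptions on `H` -/

/-- The backward travel time `inf {s > 0 : x - s v ∉ Ω}`, only used at points of `Γ₊`; there
`v ≠ 0`, so that for a bounded `Ω` the infimum is over a non-empty set. -/
def backwardTime {d : ℕ} (Ω : Set (E d)) (p : E d × E d) : ℝ :=
  sInf {s : ℝ | 0 < s ∧ p.1 - s • p.2 ∉ Ω}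

/-- `M` is the bounded operator `L¹₋ → L¹₊` given by
`(M u)(x,v) = u(x - τ₋(x,v) v, v) exp(-z τ₋(x,v))` for `(x,v) ∈ Γ₊`. -/
def IsBoundaryTransfer {d : ℕ} (Ω : Set (E d)) (m : Measure (E d)) (z : ℂ)
    (M : L1Minus Ω m →L[ℂ] L1Plus Ω m) : Prop :=
  ∀ u : L1Minus Ω m, ∀ᵐ p ∂(muPlus Ω m),
    M u p = u (p.1 - backwardTime Ω p • p.2, p.2) * Complex.exp (-z * (backwardTime Ω p : ℂ))

/-- The formula determines the operator. -/
lemma IsBoundaryTransfer.unique {d : ℕ} {Ω : Set (E d)} {m : Measure (E d)} {z : ℂ}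
    {M₁ M₂ : L1Minus Ω m →L[ℂ] L1Plus Ω m} (h₁ : IsBoundaryTransfer Ω m z M₁)
    (h₂ : IsBoundaryTransfer Ω m z M₂) : M₁ = M₂ := by
  ext1 u
  refine Lp.ext ?_
  filter_upwards [h₁ u, h₂ u] with p hp hq
  rw [hp, hq]

open Classical in
/-- The operator `M_z : L¹₋ → L¹₊`, for `Re z ≥ 0`. The formula does define a bounded operator
then, because `(x,v) ↦ (x - τ₋(x,v) v, v)` carries `μ₊` to `μ₋`. -/
def boundaryTransfer {d : ℕ} (Ω : Set (E d)) (m : Measure (E d)) (z : ℂ) :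
    L1Minus Ω m →L[ℂ] L1Plus Ω m :=
  if h : ∃ M, IsBoundaryTransfer Ω m z M then h.choose else 0

/-- `f ≥ 0` almost everywhere, for a complex-valued `f`. -/
def IsNonneg {α : Type*} [MeasurableSpace α] {μ : Measure α} (f : Lp ℂ 1 μ) : Prop :=
  ∀ᵐ p ∂μ, 0 ≤ (f p).re ∧ (f p).im = 0

/-- A nonnegative operator that preserves the integral. -/
structure IsStochastic {α β : Type*} [MeasurableSpace α] [MeasurableSpace β] {μ : Measure α}
    {ν : Measure β} (T : Lp ℂ 1 μ →L[ℂ] Lp ℂ 1 ν) : Prop where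
  nonneg : ∀ f, IsNonneg f → IsNonneg (T f)
  integral_eq : ∀ f, ∫ p, T f p ∂ν = ∫ p, f p ∂μ

/-- The image of the unit ball is relatively compact for the weak topology. -/
def IsWeaklyCompact {X Y : Type*} [NormedAddCommGroup X] [NormedSpace ℂ X]
    [NormedAddCommGroup Y] [NormedSpace ℂ Y] (T : X →L[ℂ] Y) : Prop :=
  IsCompact (closure (toWeakSpace ℂ Y '' (T '' Metric.closedBall 0 1)))

/-- The only closed (lattice) ideals of `L¹(μ)` invariant under `T` are `{0}` and `L¹(μ)`. -/
def IsIrreducibleOn {α : Type*} [MeasurableSpace α] {μ : Measure α}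
    (T : Lp ℂ 1 μ →L[ℂ] Lp ℂ 1 μ) : Prop :=
  ∀ J : Submodule ℂ (Lp ℂ 1 μ), IsClosed (J : Set (Lp ℂ 1 μ)) →
    (∀ f ∈ J, ∀ g : Lp ℂ 1 μ, (∀ᵐ p ∂μ, ‖g p‖ ≤ ‖f p‖) → g ∈ J) →
    (∀ f ∈ J, T f ∈ J) → J = ⊥ ∨ J = ⊤

/-- `H` maps `L¹₊` boundedly into `Y_k⁻ = L¹(Γ₋, max(1, |v|^{-k}) dμ₋)`. -/
def MapsIntoWeighted {d : ℕ} (Ω : Set (E d)) (m : Measure (E d))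
    (H : L1Plus Ω m →L[ℂ] L1Minus Ω m) (k : ℕ) : Prop :=
  ∃ C : ℝ≥0, ∀ ψ : L1Plus Ω m,
    ∫⁻ p, ENNReal.ofReal (max 1 ((‖p.2‖ ^ k)⁻¹)) * ‖H ψ p‖ₑ ∂(muMinus Ω m) ≤ C * ‖ψ‖ₑ

/-- The assumptions on the boundary operator `H`. -/
structure BoundaryAssumption {d : ℕ} (Ω : Set (E d)) (m : Measure (E d))
    (H : L1Plus Ω m →L[ℂ] L1Minus Ω m) : Prop where
  stochastic : IsStochastic H
  regularizing : ∃ n : ℕ, MapsIntoWeighted Ω m H (n + 1)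
  weaklyCompact : IsWeaklyCompact (H ∘L boundaryTransfer Ω m 0 ∘L H)
  irreducible : IsIrreducibleOn (boundaryTransfer Ω m 0 ∘L H)
  power_decay : ∃ l : ℕ, ∀ ε : ℝ, 0 ≤ ε →
    Tendsto (fun η : ℝ => ‖(boundaryTransfer Ω m ((ε : ℂ) + η * Complex.I) ∘L H) ^ l‖)
      (cocompact ℝ) (𝓝 0)

end Kinetic

end

/-!
Every point `iη` of the imaginary axis is an approximate eigenvalue of the transport operator,
because the velocities accumulate at `0`. Let `χ` be a smooth bump function supported in `Ω`, and
let `A` be a set of velocities `0 < |v| < δ` with `0 < m(A) < ∞`. The wave packet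
`f(x,v) = χ(x) 1_A(v) exp(-iη x·v/|v|²)` vanishes near `∂Ω`, so both its traces are zero and it
satisfies every linear boundary condition `f₋ = H f₊`. Along the characteristics the phase is
`exp(-iηt)`, so `(iη - T_H) f = v·∇χ(x) 1_A(v) exp(-iη x·v/|v|²)`, and
`‖(iη - T_H) f‖ ≤ δ m(A) ∫ |∇χ|`, whereas `‖f‖ = m(A) ∫ χ`. A bounded inverse `R` of `iη - T_H`
would thus give `∫ χ ≤ δ ‖R‖ ∫ |∇χ|` for all `δ > 0`, which is absurd.

The argument is carried by `integral_streaming_add_eq_zero` (Green's formula for functions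
vanishing near the boundary) and `exists_approximate_eigenfunction`.
-/

open Kinetic

namespace Kinetic

/-- The function `a(x,v) 1_A(v) exp(-iη x·v/|v|²)`: the amplitude `a` cut off to the velocities in
`A` and multiplied by a phase that decreases at rate `η` along the characteristics
`t ↦ (x + t v, v)`. -/
noncomputable def modulated {d : ℕ} (A : Set (E d)) (η : ℝ) (a : E d × E d → ℝ) (p : E d × E d) : ℂ :=
  ((a p * A.indicator 1 p.2 : ℝ) : ℂ) *
    Complex.exp (((-(η * (⟪p.1, p.2⟫_ℝ / ‖p.2‖ ^ 2)) : ℝ) : ℂ) * Complex.I)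

lemma norm_modulated {d : ℕ} (A : Set (E d)) (η : ℝ) (a : E d × E d → ℝ) (p : E d × E d) :
    ‖modulated A η a p‖ = |a p| * A.indicator 1 p.2 := by
  have h : 0 ≤ A.indicator (1 : E d → ℝ) p.2 := indicator_nonneg (fun _ _ => zero_le_one) _
  rw [modulated, norm_mul, Complex.norm_exp_ofReal_mul_I, mul_one, Complex.norm_real,
    Real.norm_eq_abs, abs_mul, abs_of_nonneg h]

lemma measurable_modulated {d : ℕ} {A : Set (E d)} (hA : MeasurableSet A) (η : ℝ)
    {a : E d × E d → ℝ} (ha : Measurable a) : Measurable (modulated A η a) := by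
  have h1 : Measurable fun p : E d × E d => A.indicator (1 : E d → ℝ) p.2 :=
    (measurable_one.indicator hA).comp measurable_snd
  have h2 : Measurable fun p : E d × E d => ⟪p.1, p.2⟫_ℝ :=
    (continuous_fst.inner continuous_snd).measurable
  unfold modulated
  fun_prop

lemma continuous_modulated_left {d : ℕ} (A : Set (E d)) (η : ℝ) {a : E d × E d → ℝ}
    (ha : Continuous a) (v : E d) : Continuous fun x => modulated A η a (x, v) := by
  have h1 : Continuous fun x : E d => a (x, v) * A.indicator (1 : E d → ℝ) v := by fun_prop
  have h2 : Continuous fun x : E d => -(η * (⟪x, v⟫_ℝ / ‖v‖ ^ 2)) := by fun_prop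
  exact (Complex.continuous_ofReal.comp h1).mul
    (Complex.continuous_exp.comp ((Complex.continuous_ofReal.comp h2).mul continuous_const))

/-- Green's formula without boundary terms: `F` and `G = v · ∇ₓ F` vanish for `x` outside a compact
subset of `Ω`. -/
lemma integral_streaming_add_eq_zero {d : ℕ} {Ω K : Set (E d)} (hK : IsCompact K) (hKΩ : K ⊆ Ω)
    {m : Measure (E d)} [SFinite m] {F G : E d × E d → ℂ} (hF : Integrable F (phaseMeasure Ω m))
    (hG : Integrable G (phaseMeasure Ω m)) (hFc : ∀ v, Continuous fun x => F (x, v))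
    (hGc : ∀ v, Continuous fun x => G (x, v)) (hFK : ∀ x v, x ∉ K → F (x, v) = 0)
    (hGK : ∀ x v, x ∉ K → G (x, v) = 0)
    (hd : ∀ x v, HasLineDerivAt ℝ (fun y => F (y, v)) (G (x, v)) x v)
    {φ : E d × E d → ℝ} (hφ : IsTestFunction φ) :
    ∫ p, F p * (streaming φ p : ℂ) ∂(phaseMeasure Ω m) +
      ∫ p, G p * (φ p : ℂ) ∂(phaseMeasure Ω m) = 0 := by
  have bdd : ∀ (f : E d × E d → ℂ) (h : E d × E d → ℝ), Integrable f (phaseMeasure Ω m) →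
      Continuous h → HasCompactSupport h →
      Integrable (fun p => f p * (h p : ℂ)) (phaseMeasure Ω m) := by
    intro f h hf hc hs
    obtain ⟨C, hC⟩ := hs.exists_bound_of_continuous hc
    have hb : ∀ᵐ p ∂(phaseMeasure Ω m), ‖(h p : ℂ)‖ ≤ C := ae_of_all _ fun p => by
      simpa using hC p
    exact hf.mul_bdd (Complex.continuous_ofReal.comp hc).aestronglyMeasurable hb
  have hφc := hφ.contDiff.continuous
  have hsc := hφ.continuous_streaming
  have i1 := bdd F _ hF hsc hφ.hasCompactSupport_streaming
  have i2 := bdd G _ hG hφc hφ.hasCompactSupport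
  have i3 : Integrable (fun p => F p * (streaming φ p : ℂ) + G p * (φ p : ℂ))
      (phaseMeasure Ω m) := i1.add i2
  rw [← integral_add i1 i2, phaseMeasure, integral_prod_symm _ i3]
  refine integral_eq_zero_of_ae (ae_of_all _ fun v => ?_)
  -- for a fixed velocity, integrate by parts on the whole space
  have cpt : ∀ f : E d → ℂ, (∀ x, x ∉ K → f x = 0) → Continuous f → Integrable f volume :=
    fun f h0 hc => hc.integrable_of_hasCompactSupport (HasCompactSupport.intro hK h0)
  have sl : Continuous fun x : E d => (x, v) := by fun_prop
  have c1 : Continuous fun x => (φ (x, v) : ℂ) := Complex.continuous_ofReal.comp (hφc.comp sl)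
  have c2 : Continuous fun x => (streaming φ (x, v) : ℂ) :=
    Complex.continuous_ofReal.comp (hsc.comp sl)
  have j1 : Integrable (fun x => F (x, v) * (streaming φ (x, v) : ℂ)) volume :=
    cpt _ (fun x hx => by rw [hFK x v hx, zero_mul]) ((hFc v).mul c2)
  have j2 : Integrable (fun x => G (x, v) * (φ (x, v) : ℂ)) volume :=
    cpt _ (fun x hx => by rw [hGK x v hx, zero_mul]) ((hGc v).mul c1)
  have j3 : Integrable (fun x => F (x, v) * (φ (x, v) : ℂ)) volume :=
    cpt _ (fun x hx => by rw [hFK x v hx, zero_mul]) ((hFc v).mul c1)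
  have hl : ∀ x, HasLineDerivAt ℝ (fun y => (φ (y, v) : ℂ)) (streaming φ (x, v) : ℂ) x v := by
    intro x
    have h1 : HasFDerivAt φ (fderiv ℝ φ (x, v)) (x, v) :=
      (hφ.contDiff.differentiable (by simp)).differentiableAt.hasFDerivAt
    have h2 : HasDerivAt (fun t : ℝ => (x + t • v, v)) (v, (0 : E d)) 0 := by
      refine HasDerivAt.prodMk ?_ (hasDerivAt_const _ _)
      simpa using ((hasDerivAt_id (0 : ℝ)).smul_const v).const_add x
    have h3 : HasFDerivAt φ (fderiv ℝ φ (x, v)) (x + (0 : ℝ) • v, v) := by simpa using h1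
    exact (h3.comp_hasDerivAt (0 : ℝ) h2).ofReal_comp
  have parts := integral_bilinear_hasLineDerivAt_right_eq_neg_left_of_integrable
    (μ := (volume : Measure (E d))) (B := ContinuousLinearMap.mul ℝ ℂ) j2 j1 j3
    (fun x _ => hd x v) (fun x _ => hl x)
  simp only [ContinuousLinearMap.mul_apply'] at parts
  have ext : ∫ x in Ω, (F (x, v) * (streaming φ (x, v) : ℂ) + G (x, v) * (φ (x, v) : ℂ)) =
      ∫ x, (F (x, v) * (streaming φ (x, v) : ℂ) + G (x, v) * (φ (x, v) : ℂ)) :=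
    setIntegral_eq_integral_of_forall_compl_eq_zero fun x hx => by
      rw [hFK x v fun h => hx (hKΩ h), hGK x v fun h => hx (hKΩ h), zero_mul, zero_mul, add_zero]
  change ∫ x in Ω, (F (x, v) * (streaming φ (x, v) : ℂ) + G (x, v) * (φ (x, v) : ℂ)) = 0
  rw [ext, integral_add j1 j2, parts, neg_add_cancel]

/-- The streaming derivative of a wave packet: the phase contributes the factor `-iη`. -/
lemma hasLineDerivAt_modulated {d : ℕ} {A : Set (E d)} (h0 : (0 : E d) ∉ A) (η : ℝ)
    {χ : E d → ℝ} (hχ : Differentiable ℝ χ) (x v : E d) :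
    HasLineDerivAt ℝ (fun y => modulated A η (fun p => χ p.1) (y, v))
      (modulated A η (fun p => fderiv ℝ χ p.1 p.2) (x, v) -
        (η * Complex.I) * modulated A η (fun p => χ p.1) (x, v)) x v := by
  by_cases hv : v ∈ A
  · have hv0 : ‖v‖ ^ 2 ≠ 0 := by
      have : v ≠ 0 := fun h => h0 (h ▸ hv)
      positivity
    have h1 : HasDerivAt (fun t : ℝ => χ (x + t • v)) (fderiv ℝ χ x v) 0 :=
      (hχ x).hasFDerivAt.hasLineDerivAt v
    have h2 : HasDerivAt (fun t : ℝ => -(η * (⟪x + t • v, v⟫_ℝ / ‖v‖ ^ 2))) (-η) 0 := by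
      have e : (fun t : ℝ => -(η * (⟪x + t • v, v⟫_ℝ / ‖v‖ ^ 2))) =
          fun t : ℝ => -(η * (⟪x, v⟫_ℝ / ‖v‖ ^ 2)) + t * (-η) := by
        funext t
        rw [inner_add_left, real_inner_smul_left, real_inner_self_eq_norm_sq,
          add_div, mul_div_assoc, div_self hv0]
        ring
      rw [e]
      simpa using ((hasDerivAt_id (0 : ℝ)).mul_const (-η)).const_add
        (-(η * (⟪x, v⟫_ℝ / ‖v‖ ^ 2)))
    have h3 := h1.ofReal_comp.mul ((h2.ofReal_comp.mul_const Complex.I).cexp)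
    have e : (fun t : ℝ => modulated A η (fun p => χ p.1) (x + t • v, v)) =
        (fun t : ℝ => (χ (x + t • v) : ℂ)) * fun t : ℝ =>
          Complex.exp (((-(η * (⟪x + t • v, v⟫_ℝ / ‖v‖ ^ 2)) : ℝ) : ℂ) * Complex.I) := by
      funext t
      simp only [modulated, indicator_of_mem hv, Pi.one_apply, mul_one, Pi.mul_apply]
    rw [← e] at h3
    refine h3.congr_deriv ?_
    simp only [modulated, indicator_of_mem hv, Pi.one_apply, mul_one, zero_smul, add_zero]
    push_cast
    ring
  · simp only [modulated, indicator_of_notMem hv, mul_zero, Complex.ofReal_zero, zero_mul, sub_zero]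
    exact hasDerivAt_const _ _

lemma exists_measurableSet_small_velocities {d : ℕ} {Ω : Set (E d)} {m : Measure (E d)}
    [SigmaFinite m] (hΩ : PhaseSpaceAssumption Ω m) {δ : ℝ} (hδ : 0 < δ) :
    ∃ A : Set (E d), MeasurableSet A ∧ (0 : E d) ∉ A ∧ (∀ v ∈ A, ‖v‖ ≤ δ) ∧ 0 < m A ∧ m A < ⊤ := by
  have h1 : 0 < m (Metric.ball 0 δ \ {0}) := by
    rw [measure_sdiff_null hΩ.measure_zero]
    exact (hΩ.measure_ball_pos δ hδ).trans_le (measure_mono inter_subset_right)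
  obtain ⟨A, hA, hsub, h0, hfin⟩ := Measure.exists_subset_measure_lt_top
    (Metric.isOpen_ball.measurableSet.diff (measurableSet_singleton 0)) h1
  exact ⟨A, hA, fun h => (hsub h).2 rfl,
    fun v hv => (mem_ball_zero_iff.1 (hsub hv).1).le, h0, hfin⟩

/-- A `C¹` function `χ` with compact support in `Ω` yields for all `η` and all `δ > 0` a
wave packet `f` in the domain of `T_H` with `(iη - T_H) f = r`, where the residual `r` is of order
`δ` relative to `f`. -/
lemma exists_approximate_eigenfunction {d : ℕ} {Ω : Set (E d)} {m : Measure (E d)} [SigmaFinite m]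
    (hΩ : PhaseSpaceAssumption Ω m) (H : L1Plus Ω m →L[ℂ] L1Minus Ω m) (η : ℝ) {χ : E d → ℝ}
    (hχ : ContDiff ℝ 1 χ) (hχc : HasCompactSupport χ) (hχΩ : tsupport χ ⊆ Ω) {δ : ℝ}
    (hδ : 0 < δ) :
    ∃ f r : X0 Ω m, ∃ c : ℝ, 0 < c ∧ (f, (η * Complex.I) • f - r) ∈ transportGraph Ω m H ∧
      ‖f‖ = c * ∫ x in Ω, |χ x| ∧ ‖r‖ ≤ c * (δ * ∫ x in Ω, ‖fderiv ℝ χ x‖) := by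
  obtain ⟨A, hA, hA0, hAδ, hpos, hfin⟩ := exists_measurableSet_small_velocities hΩ hδ
  have hχ' : Continuous (fderiv ℝ χ) := hχ.continuous_fderiv one_ne_zero
  have ca : Continuous fun p : E d × E d => χ p.1 := hχ.continuous.comp continuous_fst
  have cb : Continuous fun p : E d × E d => fderiv ℝ χ p.1 p.2 :=
    (hχ'.comp continuous_fst).clm_apply continuous_snd
  set F := modulated A η fun p => χ p.1 with hF
  set r := modulated A η fun p => fderiv ℝ χ p.1 p.2 with hr
  have iA : Integrable (A.indicator (1 : E d → ℝ)) m :=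
    (integrable_indicator_iff hA).2 (integrableOn_const hfin.ne)
  have bF : Integrable (fun p : E d × E d => |χ p.1| * A.indicator 1 p.2) (phaseMeasure Ω m) :=
    Integrable.mul_prod (hχ.continuous.integrable_of_hasCompactSupport hχc).abs.restrict iA
  have br : Integrable (fun p : E d × E d => (δ * ‖fderiv ℝ χ p.1‖) * A.indicator 1 p.2)
      (phaseMeasure Ω m) :=
    Integrable.mul_prod (f := fun x => δ * ‖fderiv ℝ χ x‖) (((hχ'.integrable_of_hasCompactSupport
      (hχc.fderiv (𝕜 := ℝ))).norm.const_mul δ).restrict) iA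
  have nF : ∀ p, ‖F p‖ = |χ p.1| * A.indicator 1 p.2 := fun p => norm_modulated A η _ p
  have nr : ∀ p, ‖r p‖ ≤ (δ * ‖fderiv ℝ χ p.1‖) * A.indicator 1 p.2 := by
    intro p
    rw [hr, norm_modulated]
    by_cases hp : p.2 ∈ A
    · simp only [indicator_of_mem hp, Pi.one_apply, mul_one]
      calc |fderiv ℝ χ p.1 p.2| ≤ ‖fderiv ℝ χ p.1‖ * ‖p.2‖ := (fderiv ℝ χ p.1).le_opNorm p.2
        _ ≤ ‖fderiv ℝ χ p.1‖ * δ := by gcongr; exact hAδ _ hp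
        _ = _ := mul_comm _ _
    · simp [indicator_of_notMem hp]
  have iF : Integrable F (phaseMeasure Ω m) := bF.mono'
    (measurable_modulated hA η ca.measurable).aestronglyMeasurable (ae_of_all _ fun p => (nF p).le)
  have ir : Integrable r (phaseMeasure Ω m) := br.mono'
    (measurable_modulated hA η cb.measurable).aestronglyMeasurable (ae_of_all _ nr)
  have green : ∀ φ : E d × E d → ℝ, IsTestFunction φ →
      ∫ p, F p * (streaming φ p : ℂ) ∂(phaseMeasure Ω m) +
        ∫ p, (r p - η * Complex.I * F p) * (φ p : ℂ) ∂(phaseMeasure Ω m) = 0 := by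
    intro φ hφ
    have F0 : ∀ x v, x ∉ tsupport χ → F (x, v) = 0 := fun x v hx => by
      simp [hF, modulated, image_eq_zero_of_notMem_tsupport hx]
    have r0 : ∀ x v, x ∉ tsupport χ → r (x, v) = 0 := fun x v hx => by
      have : fderiv ℝ χ x = 0 :=
        Function.notMem_support.1 fun h => hx (support_fderiv_subset ℝ h)
      simp [hr, modulated, this]
    exact integral_streaming_add_eq_zero hχc hχΩ iF (ir.sub (iF.const_mul _))
      (fun v => continuous_modulated_left A η ca v)
      (fun v => (continuous_modulated_left A η cb v).sub
        ((continuous_modulated_left A η ca v).const_mul _))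
      F0 (fun x v hx => by simp only [Pi.sub_apply, F0 x v hx, r0 x v hx, mul_zero, sub_zero])
      (fun x v => hasLineDerivAt_modulated hA0 η (hχ.differentiable one_ne_zero) x v) hφ
  have hT : HasTraces Ω m (iF.toL1 F) (-((η * Complex.I) • iF.toL1 F - ir.toL1 r)) 0 0 := by
    intro φ hφ
    have e1 : ∫ p, (iF.toL1 F) p * (streaming φ p : ℂ) ∂(phaseMeasure Ω m) =
        ∫ p, F p * (streaming φ p : ℂ) ∂(phaseMeasure Ω m) := by
      refine integral_congr_ae ?_
      filter_upwards [iF.coeFn_toL1] with p hp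
      rw [hp]
    have e2 : ∫ p, (-((η * Complex.I) • iF.toL1 F - ir.toL1 r) : X0 Ω m) p * (φ p : ℂ)
          ∂(phaseMeasure Ω m) =
        ∫ p, (r p - η * Complex.I * F p) * (φ p : ℂ) ∂(phaseMeasure Ω m) := by
      refine integral_congr_ae ?_
      rw [neg_sub]
      filter_upwards [iF.coeFn_toL1, ir.coeFn_toL1,
        Lp.coeFn_sub (ir.toL1 r) ((η * Complex.I) • iF.toL1 F),
        Lp.coeFn_smul (η * Complex.I) (iF.toL1 F)] with p h1 h2 h3 h4
      rw [h3, Pi.sub_apply, h4, Pi.smul_apply, h1, h2, smul_eq_mul]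
    have z1 : ∫ p, (0 : L1Plus Ω m) p * (φ p : ℂ) ∂(muPlus Ω m) = 0 := by
      simpa using integral_smul_mul 0 (0 : L1Plus Ω m) φ
    have z2 : ∫ p, (0 : L1Minus Ω m) p * (φ p : ℂ) ∂(muMinus Ω m) = 0 := by
      simpa using integral_smul_mul 0 (0 : L1Minus Ω m) φ
    rw [e1, e2, z1, z2, sub_zero, green φ hφ]
  have mA : ∫ v, A.indicator (1 : E d → ℝ) v ∂m = m.real A := integral_indicator_one hA
  refine ⟨iF.toL1 F, ir.toL1 r, m.real A, ENNReal.toReal_pos hpos.ne' hfin.ne,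
    ⟨fun φ hφ _ => ?_, 0, 0, hT, (map_zero H).symm⟩, ?_, ?_⟩
  · have h := hT φ hφ
    have z1 : ∫ p, (0 : L1Plus Ω m) p * (φ p : ℂ) ∂(muPlus Ω m) = 0 := by
      simpa using integral_smul_mul 0 (0 : L1Plus Ω m) φ
    have z2 : ∫ p, (0 : L1Minus Ω m) p * (φ p : ℂ) ∂(muMinus Ω m) = 0 := by
      simpa using integral_smul_mul 0 (0 : L1Minus Ω m) φ
    rw [z1, z2, sub_zero] at h
    exact eq_neg_of_add_eq_zero_left h
  · rw [L1.norm_of_fun_eq_integral_norm]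
    simp only [nF]
    rw [phaseMeasure, integral_prod_mul (fun x => |χ x|), mA, mul_comm]
  · rw [L1.norm_of_fun_eq_integral_norm]
    refine (integral_mono ir.norm br nr).trans_eq ?_
    rw [phaseMeasure, integral_prod_mul (fun x => δ * ‖fderiv ℝ χ x‖), mA, integral_const_mul,
      mul_comm]

lemma exists_bump_in_open {d : ℕ} {Ω : Set (E d)} (hΩ : IsOpen Ω) (hne : Ω.Nonempty) :
    ∃ χ : E d → ℝ, ContDiff ℝ 1 χ ∧ HasCompactSupport χ ∧ tsupport χ ⊆ Ω ∧
      0 < ∫ x in Ω, |χ x| := by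
  obtain ⟨x, hx⟩ := hne
  obtain ⟨χ, hs, hc, hd, -, h1⟩ := exists_contDiff_tsupport_subset (n := 1) (hΩ.mem_nhds hx)
  refine ⟨χ, hd, hc, hs, ?_⟩
  rw [setIntegral_eq_integral_of_forall_compl_eq_zero fun y hy => by
    rw [image_eq_zero_of_notMem_tsupport fun h => hy (hs h), abs_zero]]
  exact hd.continuous.abs.integral_pos_of_hasCompactSupport_nonneg_nonzero hc.norm
    (fun _ => abs_nonneg _) (x := x) (by simp [h1])

end Kinetic

theorem theorem4p2 {d : ℕ} (hd : 2 ≤ d) (Ω : Set (Kinetic.E d)) (m : Measure (Kinetic.E d))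
    [SigmaFinite m] (hΩ : Kinetic.PhaseSpaceAssumption Ω m)
    (H : Kinetic.L1Plus Ω m →L[ℂ] Kinetic.L1Minus Ω m)
    (hH : Kinetic.BoundaryAssumption Ω m H) :
    ∀ η : ℝ, (η : ℂ) * Complex.I ∈ Kinetic.unboundedSpectrum (Kinetic.transportOperator Ω m H) := by
  rintro η ⟨R, -, hR⟩
  obtain ⟨χ, hχ, hχc, hχΩ, hI⟩ := exists_bump_in_open hΩ.isOpen hΩ.nonempty
  set I := ∫ x in Ω, |χ x|
  set J := ∫ x in Ω, ‖fderiv ℝ χ x‖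
  have hJ : 0 ≤ J := integral_nonneg fun _ => norm_nonneg _
  -- the choice of `δ` makes `‖R‖ * (δ * J)` smaller than `I`
  have hpos : 0 < ‖R‖ * J + 1 := by positivity
  obtain ⟨f, r, c, hc, hmem, hf, hr⟩ :=
    exists_approximate_eigenfunction hΩ H η hχ hχc hχΩ (div_pos hI hpos)
  rw [← Submodule.toLinearPMap_graph_eq (transportGraph Ω m H)
    fun q hq h0 => transportGraph_singleValued hΩ.isOpen H q hq h0,
    LinearPMap.mem_graph_iff] at hmem
  obtain ⟨y, hy, hTy⟩ := hmem
  have hRr : R r = f := by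
    have h := hR y
    have hT : transportOperator Ω m H y = (η * Complex.I) • f - r := hTy
    have hy' : (y : X0 Ω m) = f := hy
    rwa [hT, hy', sub_sub_cancel] at h
  have key : c * I ≤ ‖R‖ * (c * (I / (‖R‖ * J + 1) * J)) := by
    rw [← hf, ← hRr]
    exact (R.le_opNorm r).trans (mul_le_mul_of_nonneg_left hr (norm_nonneg R))
  have e : ‖R‖ * (c * (I / (‖R‖ * J + 1) * J)) = c * I * (‖R‖ * J / (‖R‖ * J + 1)) := by
    field_simp
  have hlt : ‖R‖ * J / (‖R‖ * J + 1) < 1 := (div_lt_one hpos).2 (lt_add_one _)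
  rw [e] at key
  exact absurd key (not_le.2 (mul_lt_of_lt_one_right (mul_pos hc hI) hlt))
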